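/- Let $k$ be a field of characteristic $p>2$, with algebraic closure $\overline{k}$, and let $G$ be a finite group. A $k$-variety is a (possibly reducible) reduced separated $k$-scheme of finite type, and all actions, morphisms and rational maps are defined over $k$. A $G$-variety $X$ is called *primitive* if $G$ transitively permutes the irreducible components of $X_{\overline{k}}$, and *generically free* if there is a dense open subset $U\subset X$ such that every $\overline{k}$-point of $U$ has trivial stabilizer in $G$. If $X$ is a generically free primitive $G$-variety, a *$G$-compression* of $X$ is a dominant $G$-equivariant rational map $X \dashrightarrow Y$ to a generically free $G$-variety $Y$, and the *essential dimension* $\operatorname{ed}_k(X;G)$ is the minimal value of $\dim Y$ over all $G$-compressions $X\dashrightarrow Y$. Let $s_1, s_2$ be the first two elementary symmetric polynomials in $x_1,\dots,x_n$, and let $$X_{1,2} = \{\, s_1(x_1,\dots,x_n) = s_2(x_1,\dots,x_n) = 0 \,\} \subset \mathbb{A}^n_k,$$ with the symmetric group $\operatorname{S}_n$ acting by permuting the coordinates. **Proposition.** Assume that $n\geqslant 5$ and that $p$ divides $n$. Then $X_{1,2}$ is a generically free primitive $\operatorname{S}_n$-variety (so that its essential dimension is defined), and $$\operatorname{ed}_k(X_{1,2};\operatorname{S}_n)\leqslant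 n-4.$$ -/

import Mathlib

open CategoryTheory AlgebraicGeometry

universe u v

noncomputable section

namespace EssDim

/-- A `G`-scheme over the field `k`: a `k`-scheme `X.V` together with a homomorphism `X.ρ` from `G`
to its `k`-endomorphisms (necessarily automorphisms, as `G` is a group). Multiplication in
`End X.V` is `f * g = g ≫ f`, so this is a left action. -/
abbrev GScheme (k : Type u) [Field k] (G : Type v) [Group G] :=
  Action (Over (Spec (CommRingCat.of k))) G

/-- `Spec k̄` as a scheme over `Spec k`, where `k̄` is an algebraic closure of `k`. -/
def geomPoint (k : Type u) [Field k] : Over (Spec (CommRingCat.of k)) :=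
  Over.mk (Spec.map (CommRingCat.ofHom (algebraMap k (AlgebraicClosure k))))

section

variable {k : Type u} [Field k] {G : Type v} [Group G]

/-- A (possibly reducible) variety over `k`: a reduced separated `k`-scheme of finite type. -/
structure IsVariety (X : Over (Spec (CommRingCat.of k))) : Prop where
  reduced : IsReduced X.left
  separated : IsSeparated X.hom
  locallyOfFiniteType : LocallyOfFiniteType X.hom
  quasiCompact : QuasiCompact X.hom

/-- The base change of a `G`-scheme over `k` to the algebraic closure of `k`. -/
def geomFiber (X : GScheme k G) : GScheme (AlgebraicClosure k) G :=
  ((Over.pullback (Spec.map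
    (CommRingCat.ofHom (algebraMap k (AlgebraicClosure k))))).mapAction G).obj X

/-- The action is primitive if `G` transitively permutes the irreducible components of the base
change of `X` to the algebraic closure of `k`. -/
def IsPrimitive (X : GScheme k G) : Prop :=
  ∀ Z ∈ irreducibleComponents (geomFiber X).V.left,
    ∀ Z' ∈ irreducibleComponents (geomFiber X).V.left,
      ∃ g : G, ((geomFiber X).ρ g).left '' Z = Z'

/-- The action is generically free if there is a dense open `U ⊆ X` such that every
`k̄`-point (over `k`) lying in `U` has trivial stabilizer in `G`. -/
def IsGenericallyFree (X : GScheme k G) : Prop :=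
  ∃ U : X.V.left.Opens, Dense (U : Set X.V.left) ∧
    ∀ u : geomPoint k ⟶ X.V, Set.range u.left ⊆ (U : Set X.V.left) →
      ∀ g : G, u ≫ X.ρ g = u → g = 1

/-- A `G`-equivariant dominant rational map `X ⇢ Y` over `k`, given by an equivariant dominant
`k`-morphism defined on a `G`-stable dense open subscheme of `X`. (When `X` is reduced and `Y` is
separated, the largest domain of definition of an equivariant rational map is `G`-stable, so every
equivariant dominant rational map arises in this way.) -/
structure EquivariantDominantRationalMap (X Y : GScheme k G) where
  /-- The underlying partial map. -/
  map : X.V.left.PartialMap Y.V.left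
  map_over : map.hom ≫ Y.V.hom = map.domain.ι ≫ X.V.hom
  dominant : IsDominant map.hom
  stable : ∀ g : G, map.domain ≤ (X.ρ g).left ⁻¹ᵁ map.domain
  equivariant : ∀ g : G,
    (X.ρ g).left.resLE map.domain map.domain (stable g) ≫ map.hom = map.hom ≫ (Y.ρ g).left

/-- `Y` is the target of a `G`-compression of `X`: it is a generically free `G`-variety and there is
a `G`-equivariant dominant rational map `X ⇢ Y`. -/
def IsCompression (X Y : GScheme k G) : Prop :=
  IsVariety Y.V ∧ IsGenericallyFree Y ∧ Nonempty (EquivariantDominantRationalMap X Y)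

/-- The essential dimension `ed_k(X; G)`: the minimal dimension of `Y`, over all `G`-compressions
`X ⇢ Y`. (The infimum is `⊤` if there is no compression, and is attained otherwise.) -/
def essentialDimension (X : GScheme k G) : WithBot ℕ∞ :=
  sInf {d | ∃ Y : GScheme k G, IsCompression X Y ∧ topologicalKrullDim Y.V.left = d}

/-- The affine `G`-scheme `Spec A` attached to a left action of `G` on the `k`-algebra `A`:
`g` acts on `Spec A` by the morphism whose comorphism is the action of `g⁻¹` on `A`. -/
def specGScheme (A : Type u) [CommRing A] [Algebra k A] (φ : G →* (A ≃ₐ[k] A)) : GScheme k G where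
  V := Over.mk (Spec.map (CommRingCat.ofHom (algebraMap k A)))
  ρ :=
    { toFun := fun g => Over.homMk
        (Spec.map (CommRingCat.ofHom ((φ g⁻¹ : A ≃ₐ[k] A) : A →+* A)))
        (by
          change Spec.map _ ≫ Spec.map _ = Spec.map _
          rw [← Spec.map_comp, ← CommRingCat.ofHom_comp]
          congr 2
          ext x
          simp)
      map_one' := by
        apply Over.OverMorphism.ext
        change Spec.map _ = 𝟙 _
        rw [inv_one, map_one]
        exact Spec.map_id _
      map_mul' := fun g h => by
        apply Over.OverMorphism.ext
        change Spec.map _ = Spec.map _ ≫ Spec.map _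
        rw [← Spec.map_comp, ← CommRingCat.ofHom_comp, mul_inv_rev, map_mul]
        rfl }

end

section

variable (k : Type u) [Field k] (n : ℕ)

/-- The ideal `(s₁, s₂)` of `k[x₁, …, xₙ]` generated by the first two elementary symmetric
polynomials. -/
def idealX12 : Ideal (MvPolynomial (Fin n) k) :=
  Ideal.span {MvPolynomial.esymm (Fin n) k 1, MvPolynomial.esymm (Fin n) k 2}

lemma idealX12_map (σ : Equiv.Perm (Fin n)) :
    idealX12 k n = (idealX12 k n).map
      ((MvPolynomial.renameEquiv k σ : MvPolynomial (Fin n) k ≃ₐ[k] MvPolynomial (Fin n) k) :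
        MvPolynomial (Fin n) k →+* MvPolynomial (Fin n) k) := by
  have h (m : ℕ) : MvPolynomial.rename σ (MvPolynomial.esymm (Fin n) k m) =
      MvPolynomial.esymm (Fin n) k m := MvPolynomial.rename_esymm _ _ _ σ
  rw [idealX12, Ideal.map_span, Set.image_pair]
  congr 2
  · exact (h 1).symm
  · exact congrArg _ (h 2).symm

/-- The permutation action of the symmetric group on the coordinate ring `k[x₁, …, xₙ]/(s₁, s₂)`,
where `σ` sends the class of `xᵢ` to the class of `x_{σ(i)}`. -/
def permX12 : Equiv.Perm (Fin n) →*
    ((MvPolynomial (Fin n) k ⧸ idealX12 k n) ≃ₐ[k] (MvPolynomial (Fin n) k ⧸ idealX12 k n)) where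
  toFun σ := Ideal.quotientEquivAlg _ _ (MvPolynomial.renameEquiv k σ) (idealX12_map k n σ)
  map_one' := by
    ext x
    obtain ⟨x, rfl⟩ := Ideal.Quotient.mk_surjective x
    simp
  map_mul' σ τ := by
    ext x
    obtain ⟨x, rfl⟩ := Ideal.Quotient.mk_surjective x
    simp [MvPolynomial.rename_rename]

/-- The closed subscheme `X₁,₂` of affine `n`-space over `k` given by `s₁ = s₂ = 0`, with the action
of the symmetric group by permutation of the coordinates. -/
def X12 : GScheme k (Equiv.Perm (Fin n)) :=
  specGScheme (MvPolynomial (Fin n) k ⧸ idealX12 k n) (permX12 k n)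

end

end EssDim

end

/-! On `X12` the coordinates have vanishing sum and, since 2 is invertible, vanishing sum of
squares. As `p ∣ n`, these two equations survive not only scaling but also translation by a multiple
of (1,…,1). The two-dimensional affine group thus acts on an (n-2)-dimensional variety and commutes
with permutations; dividing by it leaves dimension n-4.

The quotient is realised by its functions: `ratioAlg` is generated by the affine-invariant ratios of
coordinate differences. Normalising two coordinates to 0 and 1 and eliminating a third by the linear
equation leaves n-3 functions bound by one nonzero quadratic relation
(`ringKrullDim_ratioAlg_succ_le`).

The inclusion of `ratioAlg` into a localization of the coordinate ring is the compression. Generic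
freeness reduces to faithfulness (`isGenericallyFree_specGScheme`), which is tested at explicit
points with nonzero coordinates 1, ω, ω², where ω² + ω + 1 = 0 (`exists_point`, `exists_ratio_ne`).
Primitivity holds because the base change of `X12` is integral: a monic quadratic is irreducible
(`irreducible_quadratic`). -/

namespace EssDim

/-! ### A quadratic over F[t] without roots -/

section

open Polynomial

/-- The quadratic `X² + (t + 1) X + (t² + t + 1)` has no root in `F[t]`. -/
lemma no_root_quadratic {F : Type*} [Field F] (h2 : (2 : F) ≠ 0) (r : F[X]) :
    r ^ 2 + (X + 1) * r + (X ^ 2 + X + 1) ≠ 0 := by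
  intro h
  -- Complete the square. The next identity is the derivative of this one.
  have hD : (2 * r + X + 1) ^ 2 = -(3 * X ^ 2 + 2 * X + 3) := by linear_combination 4 * h
  have hd : 2 * (2 * r + X + 1) * derivative (2 * r + X + 1) = -(6 * X + 2) := by
    have := congrArg derivative hD
    simp only [derivative_pow, derivative_neg, derivative_add, derivative_mul, derivative_X,
      derivative_ofNat, derivative_one] at this
    simp only [derivative_add, derivative_mul, derivative_X, derivative_ofNat, derivative_one]
    simp only [Nat.cast_ofNat, map_ofNat] at this
    linear_combination this
  have h32 : (32 : F[X]) = C (2 ^ 5) := by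
    rw [← map_ofNat C 32]; norm_num
  have hu : IsUnit (2 * r + X + 1) := by
    -- With D = 3X² + 2X + 3 one has 12D - D'² = 32. Both terms on the left are multiples of w = 2r
    -- + X + 1, because w² = -D and 2ww' = -D'. So w is constant, against the coefficient 2 of X in
    -- D. Characteristic 3 needs no separate case.
    apply isUnit_of_dvd_unit (y := (32 : F[X]))
    · refine ⟨-12 * (2 * r + X + 1) - 4 * (2 * r + X + 1) * derivative (2 * r + X + 1) ^ 2, ?_⟩
      linear_combination 12 * hD +
        (2 * (2 * r + X + 1) * derivative (2 * r + X + 1) - (6 * X + 2)) * hd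
    · rw [h32]
      exact isUnit_C.2 (isUnit_iff_ne_zero.2 (pow_ne_zero _ h2))
  obtain ⟨c, -, hc⟩ := Polynomial.isUnit_iff.1 hu
  rw [← hc, ← C_pow] at hD
  have := congrArg (fun q => coeff q 1) hD
  simp only [coeff_C, coeff_neg, coeff_add] at this
  have e3 : (3 : F[X]) = C 3 := (map_ofNat C 3).symm
  have e2 : (2 : F[X]) = C 2 := (map_ofNat C 2).symm
  rw [e3, e2] at this
  simp [coeff_C, coeff_X_pow] at this
  exact h2 this

end

noncomputable section

open MvPolynomial

/-! ### The coordinate ring and its points -/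

section Ring

variable {k : Type u} [Field k] {n : ℕ}

/-- The square of `s₁` is the sum of the squares of the variables plus `2 s₂`. -/
lemma esymm_one_sq (k : Type u) [Field k] (n : ℕ) :
    (esymm (Fin n) k 1) ^ 2 = ∑ i, (X i : MvPolynomial (Fin n) k) ^ 2 + 2 * esymm (Fin n) k 2 := by
  have h := mul_esymm_eq_sum (Fin n) k 2
  have e : (Finset.HasAntidiagonal.antidiagonal 2).filter (fun a : ℕ × ℕ => a.1 < 2) =
      ({(0, 2), (1, 1)} : Finset (ℕ × ℕ)) := by
    decide
  rw [e, Finset.sum_pair (by decide)] at h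
  simp only [esymm_zero, esymm_one, psum, pow_one] at h ⊢
  push_cast at h
  linear_combination -h

/-- The coordinate ring of `X₁,₂`. -/
def CoordRing (k : Type u) [Field k] (n : ℕ) : Type u := MvPolynomial (Fin n) k ⧸ idealX12 k n

instance : CommRing (CoordRing k n) :=
  inferInstanceAs (CommRing (MvPolynomial (Fin n) k ⧸ idealX12 k n))

instance {R : Type*} [CommRing R] [Algebra R k] : Algebra R (CoordRing k n) :=
  inferInstanceAs (Algebra R (MvPolynomial (Fin n) k ⧸ idealX12 k n))

instance {R : Type*} [CommRing R] [Algebra R k] : IsScalarTower R k (CoordRing k n) :=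
  inferInstanceAs (IsScalarTower R k (MvPolynomial (Fin n) k ⧸ idealX12 k n))

instance : Algebra.FiniteType k (CoordRing k n) :=
  inferInstanceAs (Algebra.FiniteType k (MvPolynomial (Fin n) k ⧸ idealX12 k n))

/-- The quotient map onto the coordinate ring of `X₁,₂`. -/
def toCoordRing (k : Type u) [Field k] (n : ℕ) : MvPolynomial (Fin n) k →ₐ[k] CoordRing k n :=
  Ideal.Quotient.mkₐ k (idealX12 k n)

lemma toCoordRing_eq_zero {f : MvPolynomial (Fin n) k} (hf : f ∈ idealX12 k n) :
    toCoordRing k n f = 0 :=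
  Ideal.Quotient.eq_zero_iff_mem.2 hf

/-- The coordinate functions on `X₁,₂`. -/
def coord (k : Type u) [Field k] {n : ℕ} (i : Fin n) : CoordRing k n :=
  toCoordRing k n (X i)

lemma sum_coord : ∑ i, coord k i = (0 : CoordRing k n) := by
  simp only [coord, ← map_sum, ← esymm_one (Fin n) k]
  exact toCoordRing_eq_zero (Ideal.subset_span (by simp))

lemma sum_coord_sq : ∑ i, coord k i ^ 2 = (0 : CoordRing k n) := by
  simp only [coord, ← map_sum, ← map_pow]
  rw [← sub_eq_of_eq_add (esymm_one_sq k n)]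
  refine toCoordRing_eq_zero (Ideal.sub_mem _ ?_ ?_)
  · exact Ideal.pow_mem_of_mem _ (Ideal.subset_span (by simp)) 2 (by norm_num)
  · exact Ideal.mul_mem_left _ _ (Ideal.subset_span (by simp))

/-- The permutation action on the coordinate ring of `X₁,₂`. -/
def permCoord (k : Type u) [Field k] (n : ℕ) :
    Equiv.Perm (Fin n) →* (CoordRing k n ≃ₐ[k] CoordRing k n) :=
  permX12 k n

@[simp] lemma permCoord_coord (σ : Equiv.Perm (Fin n)) (i : Fin n) :
    permCoord k n σ (coord k i) = coord k (σ i) :=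
  congrArg (toCoordRing k n) (rename_X σ i)

variable {R : Type*} [CommRing R] [Algebra k R]

/-- A solution in `R` of the equations of `X₁,₂` defines an `R`-point. -/
def CoordRing.lift (h2 : (2 : k) ≠ 0) (a : Fin n → R) (h : ∑ i, a i = 0)
    (h' : ∑ i, a i ^ 2 = 0) : CoordRing k n →ₐ[k] R :=
  Ideal.Quotient.liftₐ (idealX12 k n) (aeval a) (by
    have e1 : aeval a (esymm (Fin n) k 1) = 0 := by simp [esymm_one, h]
    -- Here division by 2 recovers s₂ from s₁ and the sum of squares.
    have e2 : aeval a (esymm (Fin n) k 2) = 0 := by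
      have := congrArg (aeval a) (esymm_one_sq k n)
      simp only [map_pow, e1, map_add, map_sum, aeval_X, h', map_mul, map_ofNat] at this
      have u : (2 : R) * algebraMap k R (2⁻¹) = 1 := by
        rw [← map_ofNat (algebraMap k R) 2, ← map_mul, mul_inv_cancel₀ h2, map_one]
      linear_combination (-algebraMap k R (2⁻¹)) * this - aeval a (esymm (Fin n) k 2) * u
    intro x hx
    change x ∈ RingHom.ker (aeval a : MvPolynomial (Fin n) k →ₐ[k] R)
    refine (Ideal.span_le.2 ?_ : idealX12 k n ≤ _) hx
    rintro _ (rfl | rfl)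
    · exact e1
    · exact e2)

@[simp] lemma CoordRing.lift_coord (h2 : (2 : k) ≠ 0) (a : Fin n → R) (h : ∑ i, a i = 0)
    (h' : ∑ i, a i ^ 2 = 0) (i : Fin n) : CoordRing.lift h2 a h h' (coord k i) = a i :=
  aeval_X a i

lemma CoordRing.algHom_ext {f g : CoordRing k n →ₐ[k] R}
    (h : ∀ i, f (coord k i) = g (coord k i)) : f = g := by
  have : f.comp (toCoordRing k n) = g.comp (toCoordRing k n) := MvPolynomial.algHom_ext h
  ext x
  obtain ⟨x, rfl⟩ := Ideal.Quotient.mk_surjective x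
  exact DFunLike.congr_fun this x

end Ring

/-! ### Integrality of the coordinate ring -/

section Domain

variable (F : Type u) [Field F] (m : ℕ)

/-- The monic quadratic cutting out `X₁,₂`, after elimination of the last variable, as a
polynomial in the last but one. -/
def quadratic : Polynomial (MvPolynomial (Fin m) F) :=
  Polynomial.X ^ 2 + Polynomial.C (∑ i, X i) * Polynomial.X +
    Polynomial.C (C 2⁻¹ * ((∑ i, X i) ^ 2 + ∑ i, X i ^ 2))

variable {F m} in
lemma eval₂_quadratic {R : Type*} [CommRing R] (f : MvPolynomial (Fin m) F →+* R) (x : R) :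
    (quadratic F m).eval₂ f x = x ^ 2 + (∑ i, f (X i)) * x +
      f (C 2⁻¹) * ((∑ i, f (X i)) ^ 2 + ∑ i, f (X i) ^ 2) := by
  simp only [quadratic, Polynomial.eval₂_add, Polynomial.eval₂_pow, Polynomial.eval₂_X,
    Polynomial.eval₂_mul, Polynomial.eval₂_C]
  simp only [map_mul, map_add, map_pow, map_sum]

lemma natDegree_quadratic : (quadratic F m).natDegree = 2 := by
  unfold quadratic; compute_degree!

lemma monic_quadratic : (quadratic F m).Monic := by
  unfold quadratic; monicity!

/-- A monic quadratic over a domain is irreducible once it has no root. Specialising the variables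
to t, 1, 0, …, 0 would turn a root into one excluded by `no_root_quadratic`. -/
lemma irreducible_quadratic (h2 : (2 : F) ≠ 0) (hm : 2 ≤ m) : Irreducible (quadratic F m) := by
  obtain ⟨m, rfl⟩ := Nat.exists_eq_add_of_le' hm
  rw [(monic_quadratic F _).irreducible_iff_roots_eq_zero_of_degree_le_three
    (natDegree_quadratic F _).ge (by rw [natDegree_quadratic]; norm_num)]
  refine Multiset.eq_zero_of_forall_notMem fun r hr => ?_
  have hr := Polynomial.isRoot_of_mem_roots hr
  let s : MvPolynomial (Fin (m + 2)) F →ₐ[F] Polynomial F :=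
    aeval (Fin.cons Polynomial.X (Fin.cons 1 0))
  apply no_root_quadratic h2 (s r)
  have := (eval₂_quadratic s.toRingHom (s r)).symm.trans
    ((Polynomial.hom_eval₂ _ (RingHom.id _) s.toRingHom r).symm.trans (congrArg s hr))
  have u : (2 : Polynomial F) * Polynomial.C (2⁻¹) = 1 := by
    rw [← map_ofNat Polynomial.C 2, ← map_mul, mul_inv_cancel₀ h2, map_one]
  simp [s, Fin.sum_univ_succ] at this
  simp only [s]
  linear_combination this - (Polynomial.X ^ 2 + Polynomial.X + 1) * u

/-- The equation s₁ = 0 eliminates coordinate 1; coordinate 0 is then a root of `quadratic` over the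
polynomial ring in the others. Irreducible elements of that factorial ring are prime, so the
adjoined-root ring is a domain. A one-sided inverse suffices to embed the coordinate ring in it. -/
theorem isDomain_coordRing_add_two (h2 : (2 : F) ≠ 0) (hm : 2 ≤ m) :
    IsDomain (CoordRing F (m + 2)) := by
  have hirr := irreducible_quadratic F m h2 hm
  have : (Ideal.span {quadratic F m}).IsPrime :=
    (Ideal.span_singleton_prime hirr.ne_zero).2 hirr.prime
  have : IsDomain (AdjoinRoot (quadratic F m)) := Ideal.Quotient.isDomain _
  have u : algebraMap F (CoordRing F (m + 2)) 2⁻¹ * 2 = 1 := by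
    rw [← map_ofNat (algebraMap F (CoordRing F (m + 2))) 2, ← map_mul, inv_mul_cancel₀ h2, map_one]
  have u' : AdjoinRoot.of (quadratic F m) (C 2⁻¹) * 2 = 1 := by
    rw [← map_ofNat (AdjoinRoot.of (quadratic F m)) 2, ← map_ofNat C 2, ← map_mul, ← map_mul,
      inv_mul_cancel₀ h2, map_one, map_one]
  have hs := sum_coord (k := F) (n := m + 2)
  have hs' := sum_coord_sq (k := F) (n := m + 2)
  simp only [Fin.sum_univ_succ, Fin.succ_zero_eq_one] at hs hs'
  let j : MvPolynomial (Fin m) F →ₐ[F] CoordRing F (m + 2) :=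
    aeval fun i : Fin m => coord F i.succ.succ
  have hj : (quadratic F m).eval₂ j.toRingHom (coord F 0) = 0 := by
    rw [eval₂_quadratic]
    simp only [j, AlgHom.toRingHom_eq_coe, RingHom.coe_coe, aeval_X, aeval_C]
    set S := ∑ i : Fin m, coord F i.succ.succ
    set P := ∑ i : Fin m, coord F i.succ.succ ^ 2
    set x := coord F (0 : Fin (m + 2))
    set y := coord F (1 : Fin (m + 2))
    set c := algebraMap F (CoordRing F (m + 2)) 2⁻¹
    linear_combination (- (x ^ 2 + S * x)) * u + c * hs' + c * (x + S - y) * hs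
  let ψ : AdjoinRoot (quadratic F m) →+* CoordRing F (m + 2) :=
    AdjoinRoot.lift j.toRingHom (coord F 0) hj
  have hr := AdjoinRoot.eval₂_root (quadratic F m)
  rw [eval₂_quadratic] at hr
  let r := AdjoinRoot.root (quadratic F m)
  let o := AdjoinRoot.of (quadratic F m)
  let φ : CoordRing F (m + 2) →ₐ[F] AdjoinRoot (quadratic F m) :=
    CoordRing.lift h2 (Fin.cons r (Fin.cons (-o (∑ i, X i) - r) fun i => o (X i)))
      (by simp only [Fin.sum_univ_succ, Fin.cons_zero, Fin.cons_succ, map_sum]; ring)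
      (by
        simp only [Fin.sum_univ_succ, Fin.cons_zero, Fin.cons_succ]
        rw [map_sum]
        set S := ∑ i : Fin m, o (X i)
        set P := ∑ i : Fin m, o (X i) ^ 2
        change r ^ 2 + S * r + o (C 2⁻¹) * (S ^ 2 + P) = 0 at hr
        change o (C 2⁻¹) * 2 = 1 at u'
        linear_combination 2 * hr - (S ^ 2 + P) * u')
  have hinv : ∀ z, ψ (φ z) = z := by
    let ψ' : AdjoinRoot (quadratic F m) →ₐ[F] CoordRing F (m + 2) :=
      { ψ with
        commutes' := fun c => by
          change ψ (o (C c)) = _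
          simp [ψ, o, j] }
    have : ψ'.comp φ = AlgHom.id F _ := by
      apply CoordRing.algHom_ext
      intro i
      change ψ (φ (coord F i)) = coord F i
      simp only [φ, CoordRing.lift_coord]
      refine Fin.cases ?_ (fun i => Fin.cases ?_ (fun i => ?_) i) i
      · simp [ψ, r]
      · simp [ψ, r, o, j]
        linear_combination - hs
      · simp [ψ, o, j]
    exact fun z => DFunLike.congr_fun this z
  exact (Function.LeftInverse.injective hinv).isDomain φ.toRingHom

theorem isDomain_coordRing (h2 : (2 : F) ≠ 0) {n : ℕ} (hn : 4 ≤ n) : IsDomain (CoordRing F n) := by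
  obtain ⟨m, rfl⟩ := Nat.exists_eq_add_of_le' (le_trans (by norm_num) hn : 2 ≤ n)
  exact isDomain_coordRing_add_two F m h2 (by omega)

end Domain

/-! ### Affine G-schemes and rational maps between them -/

section Affine

variable {k : Type u} [Field k] {G : Type v} [Group G]

section

variable {A : Type u} [CommRing A] [Algebra k A]

lemma isVariety_specGScheme [_root_.IsReduced A] [Algebra.FiniteType k A] (φ : G →* (A ≃ₐ[k] A)) :
    IsVariety (specGScheme A φ).V where
  reduced := inferInstanceAs (IsReduced (Spec (CommRingCat.of A)))
  separated := inferInstanceAs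
    (IsSeparated (Spec.map (CommRingCat.ofHom (algebraMap k A))))
  locallyOfFiniteType := by
    change LocallyOfFiniteType (Spec.map (CommRingCat.ofHom (algebraMap k A)))
    rw [HasRingHomProperty.Spec_iff (P := @LocallyOfFiniteType)]
    exact RingHom.finiteType_algebraMap.2 inferInstance
  quasiCompact := inferInstanceAs
    (QuasiCompact (Spec.map (CommRingCat.ofHom (algebraMap k A))))

/-- A faithful action of a finite group on an integral affine scheme is generically free. -/
theorem isGenericallyFree_specGScheme [IsDomain A] [Finite G] (φ : G →* (A ≃ₐ[k] A))
    (hφ : ∀ g, g ≠ 1 → ∃ a, φ g a ≠ a) : IsGenericallyFree (specGScheme A φ) := by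
  classical
  have := Fintype.ofFinite G
  choose a ha using hφ
  -- One factor for each g ≠ 1, nonzero because g moves the chosen function. A geometric point fixed
  -- by g kills the factor of g⁻¹, since the comorphism of g is the action of g⁻¹.
  let d : A := ∏ g : {g : G // g ≠ 1}, (φ g (a g g.2) - a g g.2)
  have hd : d ≠ 0 := Finset.prod_ne_zero_iff.2 fun g _ => sub_ne_zero.2 (ha g g.2)
  refine ⟨PrimeSpectrum.basicOpen d, ?_, fun u hu g hg => ?_⟩
  · refine (PrimeSpectrum.basicOpen d).isOpen.dense ⟨⟨⊥, Ideal.isPrime_bot⟩, ?_⟩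
    exact hd
  · by_contra hg1
    obtain ⟨h, hh⟩ : ∃ h, Spec.map h = u.left := ⟨Spec.preimage u.left, Spec.map_preimage _⟩
    have hg1 : g⁻¹ ≠ 1 := inv_ne_one.2 hg1
    have hfix : ∀ b : A, h.hom (φ g⁻¹ b) = h.hom b := by
      have := congrArg CommaMorphism.left hg
      change u.left ≫ Spec.map _ = u.left at this
      have key : Spec.map (CommRingCat.ofHom ((φ g⁻¹ : A ≃ₐ[k] A) : A →+* A) ≫ h) = Spec.map h :=
        (Spec.map_comp _ _).trans ((congrArg (· ≫ Spec.map _) hh).trans (this.trans hh.symm))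
      exact fun b => congr($(Spec.map_injective key) b)
    have h0 : h.hom d = 0 := by
      rw [map_prod]
      refine Finset.prod_eq_zero (Finset.mem_univ ⟨g⁻¹, hg1⟩) ?_
      rw [map_sub, hfix, sub_self]
    have hmem := hu ⟨(⟨⊥, Ideal.isPrime_bot⟩ : PrimeSpectrum (AlgebraicClosure k)), rfl⟩
    rw [← hh] at hmem
    exact hmem h0

/-- An affine `G`-scheme is primitive if its base change to the algebraic closure is integral. -/
theorem isPrimitive_specGScheme (φ : G →* (A ≃ₐ[k] A))
    [IsDomain (TensorProduct k A (AlgebraicClosure k))] : IsPrimitive (specGScheme A φ) := by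
  have hirr : IrreducibleSpace (geomFiber (specGScheme A φ)).V.left :=
    (Scheme.homeoOfIso (pullbackSpecIso k A (AlgebraicClosure k))).symm.surjective.irreducibleSpace
      (Scheme.homeoOfIso (pullbackSpecIso k A (AlgebraicClosure k))).symm.continuous
  intro Z hZ Z' hZ'
  rw [irreducibleComponents_eq_singleton, Set.mem_singleton_iff] at hZ hZ'
  refine ⟨1, ?_⟩
  rw [hZ, hZ', map_one]
  exact Set.image_id _

end

section

/-- The action by automorphisms defined by an action by endomorphisms. -/
def autOfEnd {A : Type*} [CommRing A] [Algebra k A] (ρ : G →* (A →ₐ[k] A)) : G →* (A ≃ₐ[k] A) :=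
  (AlgEquiv.algHomUnitsEquiv k A).toMonoidHom.comp ρ.toHomUnits

variable {A : Type u} [CommRing A] [Algebra k A] (φ : G →* (A ≃ₐ[k] A)) (f : A)

/-- The action on the localization at an invariant element. -/
def awayAction (hf : ∀ g, φ g f = f) :
    G →* (Localization.Away f →ₐ[k] Localization.Away f) where
  toFun g := IsLocalization.liftAlgHom (M := Submonoid.powers f)
    (f := (IsScalarTower.toAlgHom k A (Localization.Away f)).comp (φ g : A →ₐ[k] A)) (by
      rintro ⟨_, m, rfl⟩
      simpa [hf] using (IsLocalization.Away.algebraMap_isUnit f).pow m)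
  map_one' := by
    refine IsLocalization.algHom_ext (Submonoid.powers f) (AlgHom.ext fun a => ?_)
    change IsLocalization.lift _ (algebraMap A _ a) = algebraMap A _ a
    rw [IsLocalization.lift_eq]
    simp
  map_mul' g h := by
    refine IsLocalization.algHom_ext (Submonoid.powers f) (AlgHom.ext fun a => ?_)
    change IsLocalization.lift _ (algebraMap A _ a) =
      IsLocalization.lift _ (IsLocalization.lift _ (algebraMap A _ a))
    simp only [IsLocalization.lift_eq]
    change algebraMap A _ (φ (g * h) a) = IsLocalization.lift _ (algebraMap A _ (φ h a))
    simp [IsLocalization.lift_eq]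

@[simp] lemma awayAction_algebraMap (hf : ∀ g, φ g f = f) (g : G) (a : A) :
    awayAction φ f hf g (algebraMap A _ a) = algebraMap A _ (φ g a) := by
  simp [awayAction]

variable {φ f}

/-- A stable subalgebra of the localization at an invariant element defines a dominant equivariant
rational map. -/
def rationalMapOfInjective [IsDomain A] (hf0 : f ≠ 0) (hf : ∀ g, φ g f = f) {B : Type u}
    [CommRing B] [Algebra k B] (φB : G →* (B ≃ₐ[k] B)) (ψ : B →ₐ[k] Localization.Away f)
    (hψ : Function.Injective ψ) (hψG : ∀ g b, ψ (φB g b) = awayAction φ f hf g (ψ b)) :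
    EquivariantDominantRationalMap (specGScheme A φ) (specGScheme B φB) where
  map :=
    { domain := PrimeSpectrum.basicOpen f
      dense_domain := (PrimeSpectrum.basicOpen f).isOpen.dense ⟨⟨⊥, Ideal.isPrime_bot⟩, hf0⟩
      hom := (basicOpenIsoSpecAway (R := CommRingCat.of A) f).hom ≫
        Spec.map (CommRingCat.ofHom ψ.toRingHom) }
  map_over := by
    change ((basicOpenIsoSpecAway (R := CommRingCat.of A) f).hom ≫
        Spec.map (CommRingCat.ofHom ψ.toRingHom)) ≫
        Spec.map (CommRingCat.ofHom (algebraMap k B)) =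
      Scheme.Opens.ι (X := Spec (CommRingCat.of A)) (PrimeSpectrum.basicOpen f) ≫
        Spec.map (CommRingCat.ofHom (algebraMap k A))
    set U : (Spec (CommRingCat.of A)).Opens := PrimeSpectrum.basicOpen f
    set i := (basicOpenIsoSpecAway (R := CommRingCat.of A) f).hom
    have hi : i ≫ Spec.map (CommRingCat.ofHom (algebraMap A (Localization.Away f))) = U.ι :=
      basicOpenIsoSpecAway_hom_SpecMap (R := CommRingCat.of A) f
    rw [← hi, Category.assoc, Category.assoc, ← Spec.map_comp, ← Spec.map_comp]
    congr 2
    ext x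
    exact (ψ.commutes x).trans (IsScalarTower.algebraMap_apply k A _ x)
  dominant := by
    have : IsDominant (Spec.map (CommRingCat.ofHom ψ.toRingHom)) := by
      refine ⟨(PrimeSpectrum.denseRange_comap_iff_ker_le_nilRadical _).2 ?_⟩
      change RingHom.ker ψ.toRingHom ≤ _
      rw [(RingHom.injective_iff_ker_eq_bot ψ.toRingHom).1 hψ]
      exact bot_le
    change IsDominant ((basicOpenIsoSpecAway (R := CommRingCat.of A) f).hom ≫
        Spec.map (CommRingCat.ofHom ψ.toRingHom))
    infer_instance
  stable g x hx := by
    change φ g⁻¹ f ∉ x.asIdeal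
    rw [hf]
    exact hx
  equivariant g := by
    set U : (Spec (CommRingCat.of A)).Opens := PrimeSpectrum.basicOpen f
    set i := (basicOpenIsoSpecAway (R := CommRingCat.of A) f).hom
    have hi : i ≫ Spec.map (CommRingCat.ofHom (algebraMap A (Localization.Away f))) = U.ι :=
      basicOpenIsoSpecAway_hom_SpecMap (R := CommRingCat.of A) f
    have hres : ∀ (α : Spec (CommRingCat.of A) ⟶ Spec (CommRingCat.of A)) (h : U ≤ α ⁻¹ᵁ U),
        α = Spec.map (CommRingCat.ofHom ((φ g⁻¹ : A ≃ₐ[k] A) : A →+* A)) →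
        α.resLE U U h ≫ i =
          i ≫ Spec.map (CommRingCat.ofHom (awayAction φ f hf g⁻¹).toRingHom) := by
      intro α h hα
      -- The localization map gives a monomorphism into Spec A, so the equality may be checked
      -- there.
      have : Mono (Spec.map (CommRingCat.ofHom (algebraMap A (Localization.Away f)))) :=
        inferInstance
      rw [← cancel_mono (Spec.map (CommRingCat.ofHom (algebraMap A (Localization.Away f)))),
        Category.assoc, hi, Scheme.Hom.resLE_comp_ι, Category.assoc, ← Spec.map_comp, ← hi, hα,
        Category.assoc, ← Spec.map_comp]
      congr 2
      ext a
      exact (awayAction_algebraMap φ f hf g⁻¹ a).symm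
    change Scheme.Hom.resLE _ U U _ ≫ i ≫ Spec.map (CommRingCat.ofHom ψ.toRingHom) =
      (i ≫ Spec.map (CommRingCat.ofHom ψ.toRingHom)) ≫
        Spec.map (CommRingCat.ofHom ((φB g⁻¹ : B ≃ₐ[k] B) : B →+* B))
    refine ((Category.assoc _ _ _).symm.trans (congrArg (· ≫ Spec.map (CommRingCat.ofHom
      ψ.toRingHom)) (hres _ _ rfl))).trans ?_
    dsimp only
    rw [Category.assoc, Category.assoc, ← Spec.map_comp, ← Spec.map_comp]
    congr 2
    ext b
    exact (hψG g⁻¹ b).symm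

end

end Affine

/-! ### Dimension bounds -/

/-- A ring map `θ` is injective on prime spectra if up to units every element of the target is in
the image, whence a bound on the dimension. -/
lemma ringKrullDim_le_of_unit_mul_mem_range {P B : Type*} [CommRing P] [CommRing B] (θ : P →+* B)
    (h : ∀ b, ∃ d p, IsUnit (θ d) ∧ θ d * b = θ p) : ringKrullDim B ≤ ringKrullDim P := by
  -- Membership of b in a prime is equivalent to membership of θ p, so contraction reflects
  -- inclusions and keeps chains strict.
  have key : ∀ q q' : PrimeSpectrum B,
      PrimeSpectrum.comap θ q ≤ PrimeSpectrum.comap θ q' → q ≤ q' := by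
    intro q q' hq b hb
    obtain ⟨d, p, hd, hp⟩ := h b
    have : p ∈ (PrimeSpectrum.comap θ q').asIdeal :=
      hq (show θ p ∈ q.asIdeal from hp ▸ q.asIdeal.mul_mem_left _ hb)
    change θ p ∈ q'.asIdeal at this
    rw [← hp] at this
    exact (Ideal.unit_mul_mem_iff_mem _ hd).1 this
  exact Order.krullDim_le_of_strictMono (PrimeSpectrum.comap θ) fun q q' hq =>
    ⟨fun b hb => hq.le hb, fun hle => hq.not_ge (key _ _ hle)⟩

/-- A hypersurface in affine space of dimension `m` has dimension less than `m`. -/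
lemma ringKrullDim_succ_le_of_ker {k : Type*} [Field k] {m : ℕ} {B : Type*} [CommRing B]
    (θ : MvPolynomial (Fin m) k →+* B) (h : ∀ b, ∃ d p, IsUnit (θ d) ∧ θ d * b = θ p)
    {f : MvPolynomial (Fin m) k} (hf : f ≠ 0) (hθ : θ f = 0) :
    ringKrullDim B + 1 ≤ m := by
  have hB : ringKrullDim B ≤ ringKrullDim (MvPolynomial (Fin m) k ⧸ Ideal.span {f}) := by
    refine ringKrullDim_le_of_unit_mul_mem_range (Ideal.Quotient.lift (Ideal.span {f}) θ ?_) ?_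
    · intro a ha
      obtain ⟨c, rfl⟩ := Ideal.mem_span_singleton.1 ha
      rw [map_mul, hθ, zero_mul]
    · intro b
      obtain ⟨d, p, hd⟩ := h b
      exact ⟨Ideal.Quotient.mk _ d, Ideal.Quotient.mk _ p, by simpa using hd⟩
  refine (add_le_add_left hB 1).trans ((ringKrullDim_quotient_succ_le_of_nonZeroDivisor
    (mem_nonZeroDivisors_of_ne_zero hf)).trans ?_)
  rw [MvPolynomial.ringKrullDim_of_isNoetherianRing, ringKrullDim_eq_zero_of_field]
  simp

/-! ### Geometric integrality -/

section BaseChange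

variable (k : Type u) [Field k]

/-- Base change of the coordinate ring of `X₁,₂` to the algebraic closure. -/
def coordRingBaseChange (h2 : (2 : k) ≠ 0) (n : ℕ) :
    TensorProduct k (CoordRing k n) (AlgebraicClosure k) →ₐ[k]
      CoordRing (AlgebraicClosure k) n :=
  Algebra.TensorProduct.productMap
    (CoordRing.lift h2 (fun i => coord (AlgebraicClosure k) i) sum_coord sum_coord_sq)
    (IsScalarTower.toAlgHom k (AlgebraicClosure k) (CoordRing (AlgebraicClosure k) n))

/-- The universal property over the algebraic closure provides a left inverse; this is enough to
transport integrality. -/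
theorem coordRingBaseChange_injective (h2 : (2 : k) ≠ 0) (n : ℕ) :
    Function.Injective (coordRingBaseChange k h2 n) := by
  have h2' : (2 : AlgebraicClosure k) ≠ 0 := by
    rw [← map_ofNat (algebraMap k (AlgebraicClosure k)) 2]
    exact (map_ne_zero _).2 h2
  let : Algebra (AlgebraicClosure k) (TensorProduct k (CoordRing k n) (AlgebraicClosure k)) :=
    Algebra.TensorProduct.rightAlgebra
  let ι : CoordRing k n →ₐ[k] TensorProduct k (CoordRing k n) (AlgebraicClosure k) :=
    Algebra.TensorProduct.includeLeft
  let s : CoordRing (AlgebraicClosure k) n →ₐ[AlgebraicClosure k]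
      TensorProduct k (CoordRing k n) (AlgebraicClosure k) :=
    CoordRing.lift h2' (fun i => ι (coord k i))
      (by rw [← map_zero ι, ← sum_coord, map_sum])
      (by
        rw [← map_zero ι, ← sum_coord_sq, map_sum]
        exact Finset.sum_congr rfl fun i _ => (map_pow ι _ 2).symm)
  have hι : ((s.restrictScalars k).comp (coordRingBaseChange k h2 n)).comp ι = ι := by
    apply CoordRing.algHom_ext
    intro i
    simp [coordRingBaseChange, s, ι]
  have hs : (s.restrictScalars k).comp (coordRingBaseChange k h2 n) = AlgHom.id k _ := by
    refine Algebra.TensorProduct.ext hι (AlgHom.ext fun c => ?_)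
    simp only [coordRingBaseChange, AlgHom.coe_comp, AlgHom.coe_restrictScalars',
        Function.comp_apply,
        Algebra.TensorProduct.includeRight_apply, Algebra.TensorProduct.productMap_apply_tmul,
        map_one, one_mul, IsScalarTower.coe_toAlgHom', AlgHom.commutes]
    rfl
  exact Function.LeftInverse.injective (g := s) fun z => DFunLike.congr_fun hs z

theorem isDomain_coordRing_tensorProduct (h2 : (2 : k) ≠ 0) {n : ℕ} (hn : 4 ≤ n) :
    IsDomain (TensorProduct k (CoordRing k n) (AlgebraicClosure k)) := by
  have h2' : (2 : AlgebraicClosure k) ≠ 0 := by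
    rw [← map_ofNat (algebraMap k (AlgebraicClosure k)) 2]
    exact (map_ne_zero _).2 h2
  have := isDomain_coordRing (AlgebraicClosure k) h2' hn
  exact (coordRingBaseChange_injective k h2 n).isDomain (coordRingBaseChange k h2 n).toRingHom

end BaseChange

/-! ### Points built from cube roots of unity -/

section Point

/-- A point of `X₁,₂` with two vanishing coordinates `m, j` and whose coordinates `t, s` are
distinct, where `t ∉ {m, j, s}`. -/
lemma exists_point {K : Type*} [Field K] [IsAlgClosed K] {n : ℕ} (hn : 5 ≤ n)
    (hn3 : (3 : K) = 0 → 6 ≤ n) {m j t s : Fin n} (hmt : m ≠ t) (hjt : j ≠ t) (hst : s ≠ t) :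
    ∃ a : Fin n → K, ∑ i, a i = 0 ∧ ∑ i, a i ^ 2 = 0 ∧ a m = 0 ∧ a j = 0 ∧ a t = 1 ∧ a s ≠ 1 := by
  classical
  -- These indices will carry ω and ω². They need to avoid s only in characteristic 3, where ω = 1;
  -- the stronger bound `6 ≤ n` then leaves room.
  obtain ⟨u, v, huv, hu, hv, hs⟩ : ∃ u v : Fin n, u ≠ v ∧ u ∉ ({t, m, j} : Finset (Fin n)) ∧
      v ∉ ({t, m, j} : Finset (Fin n)) ∧ ((3 : K) = 0 → u ≠ s ∧ v ≠ s) := by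
    by_cases h3 : (3 : K) = 0
    · have hc : 1 < (({t, m, j, s} : Finset (Fin n))ᶜ).card := by
        have := hn3 h3
        have := Finset.card_le_four (a := t) (b := m) (c := j) (d := s)
        rw [Finset.card_compl, Fintype.card_fin]
        omega
      obtain ⟨u, hu, v, hv, huv⟩ := Finset.one_lt_card.1 hc
      simp only [Finset.mem_compl, Finset.mem_insert, Finset.mem_singleton, not_or] at hu hv ⊢
      exact ⟨u, v, huv, by tauto, by tauto, by tauto⟩
    · have hc : 1 < (({t, m, j} : Finset (Fin n))ᶜ).card := by
        have := Finset.card_le_three (a := t) (b := m) (c := j)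
        rw [Finset.card_compl, Fintype.card_fin]
        omega
      obtain ⟨u, hu, v, hv, huv⟩ := Finset.one_lt_card.1 hc
      exact ⟨u, v, huv, Finset.mem_compl.1 hu, Finset.mem_compl.1 hv, fun h => absurd h h3⟩
  simp only [Finset.mem_insert, Finset.mem_singleton, not_or] at hu hv
  obtain ⟨ω, hω⟩ : ∃ ω : K, ω ^ 2 + ω + 1 = 0 := by
    obtain ⟨ω, hω⟩ := IsAlgClosed.exists_root
      (Polynomial.X ^ 2 + Polynomial.X + 1 : Polynomial K) (by
        have : (Polynomial.X ^ 2 + Polynomial.X + 1 : Polynomial K).degree = 2 := by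
          compute_degree!
        rw [this]; norm_num)
    exact ⟨ω, by simpa using hω⟩
  let a : Fin n → K := Pi.single t 1 + Pi.single u ω + Pi.single v (ω ^ 2)
  have ht : a t = 1 := by simp [a, Ne.symm hu.1, Ne.symm hv.1]
  have hau : a u = ω := by simp [a, hu.1, huv]
  have hav : a v = ω ^ 2 := by simp [a, hv.1, huv.symm]
  have ha0 : ∀ i, i ≠ t → i ≠ u → i ≠ v → a i = 0 := fun i h1 h2 h3 => by simp [a, h1, h2, h3]
  have hsq : ∀ i, a i ^ 2 = (Pi.single t 1 + Pi.single u (ω ^ 2) + Pi.single v (ω ^ 4) :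
      Fin n → K) i := by
    intro i
    by_cases h1 : i = t
    · subst h1; rw [ht]; simp [Ne.symm hu.1, Ne.symm hv.1]
    by_cases h2 : i = u
    · subst h2; rw [hau]; simp [h1, huv]
    by_cases h3 : i = v
    · subst h3; rw [hav]; simp [h1, h2]; ring
    · rw [ha0 i h1 h2 h3]; simp [h1, h2, h3]
  refine ⟨a, ?_, ?_, ha0 m hmt (Ne.symm hu.2.1) (Ne.symm hv.2.1),
    ha0 j hjt (Ne.symm hu.2.2) (Ne.symm hv.2.2), ht, ?_⟩
  · simp only [a, Pi.add_apply, Finset.sum_add_distrib, Fintype.sum_pi_single']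
    linear_combination hω
  · simp only [hsq, Pi.add_apply, Finset.sum_add_distrib, Fintype.sum_pi_single']
    linear_combination (ω ^ 2 - ω + 1) * hω
  · by_cases hsu : s = u
    · intro h
      rw [hsu, hau] at h
      rw [h] at hω
      exact (hs (by linear_combination hω)).1 hsu.symm
    by_cases hsv : s = v
    · intro h
      rw [hsv, hav] at h
      -- If ω² = 1, then ω = -2, hence 4 = 1 and 3 = 0, a case in which v avoids s.
      have hω2 : ω = -2 := by linear_combination hω - h
      rw [hω2] at h
      exact (hs (by linear_combination h)).2 hsv.symm
    · rw [ha0 s hst hsu hsv]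
      exact zero_ne_one

end Point

/-! ### The algebra of affine-invariant ratios -/

section Ratios

variable (k : Type u) [Field k] (n : ℕ)

/-- The product of the differences of distinct coordinates. -/
def discr : CoordRing k n := ∏ i, ∏ j, if i = j then 1 else coord k i - coord k j

variable {n}

/-- The product runs over ordered pairs, so permutations fix it exactly and not merely up to sign.
-/
lemma permCoord_discr (σ : Equiv.Perm (Fin n)) : permCoord k n σ (discr k n) = discr k n := by
  simp only [discr, map_prod, apply_ite (permCoord k n σ), map_one, map_sub, permCoord_coord]
  refine Eq.trans (Finset.prod_congr rfl fun i _ => ?_) (Equiv.prod_comp σ _)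
  refine Eq.trans ?_ (Equiv.prod_comp σ _)
  simp

lemma sub_dvd_discr {i j : Fin n} (h : i ≠ j) : coord k i - coord k j ∣ discr k n := by
  refine Dvd.dvd.trans ?_ (Finset.dvd_prod_of_mem _ (Finset.mem_univ i))
  refine Dvd.dvd.trans ?_ (Finset.dvd_prod_of_mem _ (Finset.mem_univ j))
  rw [if_neg h]

variable (n) in
/-- The coordinate ring of the locus of points of `X₁,₂` with distinct coordinates. -/
abbrev DistinctRing : Type u := Localization.Away (discr k n)

/-- The coordinates as functions on the locus of points with distinct coordinates. -/
def dcoord (i : Fin n) : DistinctRing k n := algebraMap (CoordRing k n) _ (coord k i)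

lemma isUnit_dcoord_sub {i j : Fin n} (h : i ≠ j) : IsUnit (dcoord k i - dcoord k j) := by
  rw [dcoord, dcoord, ← map_sub]
  exact isUnit_of_dvd_unit (map_dvd _ (sub_dvd_discr k h))
    (IsLocalization.Away.algebraMap_isUnit (discr k n))

variable (n) in
/-- The permutation action on the locus of points with distinct coordinates. -/
def dperm : Equiv.Perm (Fin n) →* (DistinctRing k n →ₐ[k] DistinctRing k n) :=
  awayAction (permCoord k n) (discr k n) (permCoord_discr k)

@[simp] lemma dperm_dcoord (σ : Equiv.Perm (Fin n)) (i : Fin n) :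
    dperm k n σ (dcoord k i) = dcoord k (σ i) := by
  rw [dperm, dcoord, awayAction_algebraMap, permCoord_coord]
  rfl

/-- The ratio `(xᵢ - xⱼ) / (xₐ - x_b)` of differences of coordinates. -/
def ratio (i j a b : Fin n) : DistinctRing k n :=
  (dcoord k i - dcoord k j) * Ring.inverse (dcoord k a - dcoord k b)

lemma sub_mul_ratio {a b : Fin n} (h : a ≠ b) (i j : Fin n) :
    (dcoord k a - dcoord k b) * ratio k i j a b = dcoord k i - dcoord k j := by
  rw [ratio, mul_left_comm, Ring.mul_inverse_cancel _ (isUnit_dcoord_sub k h), mul_one]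

/-- The default value 0 of `Ring.inverse` at 0 lets all quadruples index the generators, with
`dperm_ratio` valid without exception. -/
lemma ratio_self_right (i j a : Fin n) : ratio k i j a a = 0 := by
  rw [ratio, sub_self, Ring.inverse_zero, mul_zero]

lemma dperm_ratio (σ : Equiv.Perm (Fin n)) (i j a b : Fin n) :
    dperm k n σ (ratio k i j a b) = ratio k (σ i) (σ j) (σ a) (σ b) := by
  by_cases h : a = b
  · rw [h, ratio_self_right, ratio_self_right, map_zero]
  · have hσ : σ a ≠ σ b := σ.injective.ne h
    apply (isUnit_dcoord_sub k hσ).mul_left_cancel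
    rw [sub_mul_ratio k hσ]
    have := congrArg (dperm k n σ) (sub_mul_ratio k h i j)
    simpa using this

variable (n) in
/-- The algebra generated by the ratios of differences of coordinates. -/
def ratioAlg : Subalgebra k (DistinctRing k n) :=
  Algebra.adjoin k (Set.range fun q : Fin n × Fin n × Fin n × Fin n =>
    ratio k q.1 q.2.1 q.2.2.1 q.2.2.2)

lemma ratio_mem (i j a b : Fin n) : ratio k i j a b ∈ ratioAlg k n :=
  Algebra.subset_adjoin ⟨(i, j, a, b), rfl⟩

variable (n) in
lemma finiteType_ratioAlg : Algebra.FiniteType k (ratioAlg k n) :=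
  (Subalgebra.fg_iff_finiteType _).1 (Subalgebra.fg_def.2 ⟨_, Set.finite_range _, rfl⟩)

lemma dperm_mem (σ : Equiv.Perm (Fin n)) {x : DistinctRing k n} (hx : x ∈ ratioAlg k n) :
    dperm k n σ x ∈ ratioAlg k n := by
  have : ratioAlg k n ≤ (ratioAlg k n).comap (dperm k n σ) := by
    refine Algebra.adjoin_le ?_
    rintro _ ⟨q, rfl⟩
    change dperm k n σ _ ∈ ratioAlg k n
    rw [dperm_ratio]
    exact ratio_mem k _ _ _ _
  exact this hx

variable (n) in
/-- The permutation action on the algebra of ratios of differences of coordinates. -/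
def ratioPerm : Equiv.Perm (Fin n) →* (ratioAlg k n ≃ₐ[k] ratioAlg k n) :=
  autOfEnd
    { toFun := fun σ => ((dperm k n σ).comp (ratioAlg k n).val).codRestrict (ratioAlg k n)
        fun x => dperm_mem k σ x.2
      map_one' := by ext x; simp
      map_mul' := fun σ τ => AlgHom.ext fun x =>
        Subtype.ext congr($(map_mul (dperm k n) σ τ) (x : DistinctRing k n)) }

@[simp] lemma coe_ratioPerm (σ : Equiv.Perm (Fin n)) (x : ratioAlg k n) :
    (ratioPerm k n σ x : DistinctRing k n) = dperm k n σ x := rfl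

end Ratios

/-! ### Dimension of the ratio algebra -/

section Dimension

variable {k : Type u} [Field k] {m : ℕ}

/-- The affine coordinate `(xᵢ - x₀) / (x₁ - x₀)`. -/
def normCoord (i : Fin (m + 3)) : ratioAlg k (m + 3) :=
  ⟨ratio k i 0 1 0, ratio_mem k _ _ _ _⟩

lemma sub_mul_normCoord (i : Fin (m + 3)) :
    (dcoord k 1 - dcoord k 0) * (normCoord (k := k) i : DistinctRing k (m + 3)) =
      dcoord k i - dcoord k 0 :=
  sub_mul_ratio k (by simp) i 0

lemma isUnit_dcoord_one_sub_zero :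
    IsUnit (dcoord k (1 : Fin (m + 3)) - dcoord k 0) :=
  isUnit_dcoord_sub k (by simp)

lemma normCoord_zero : normCoord (k := k) (0 : Fin (m + 3)) = 0 := by
  apply Subtype.ext
  apply (isUnit_dcoord_one_sub_zero (k := k) (m := m)).mul_left_cancel
  rw [sub_mul_normCoord]
  simp

lemma normCoord_one : normCoord (k := k) (1 : Fin (m + 3)) = 1 := by
  apply Subtype.ext
  apply (isUnit_dcoord_one_sub_zero (k := k) (m := m)).mul_left_cancel
  rw [sub_mul_normCoord]
  simp

/-- Ratios of differences do not change under the affine normalisation, so each one is a fraction in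
the normalised coordinates. -/
lemma normCoord_sub_mul_ratio {a b : Fin (m + 3)} (h : a ≠ b) (i j : Fin (m + 3)) :
    (normCoord (k := k) a - normCoord b) * ⟨ratio k i j a b, ratio_mem k _ _ _ _⟩ =
      normCoord i - normCoord j := by
  apply Subtype.ext
  apply (isUnit_dcoord_one_sub_zero (k := k) (m := m)).mul_left_cancel
  push_cast
  linear_combination ratio k i j a b * (sub_mul_normCoord (k := k) a - sub_mul_normCoord (k := k) b) -
    sub_mul_normCoord (k := k) i + sub_mul_normCoord (k := k) j + sub_mul_ratio k h i j

/-- The inverse is itself one of the generating ratios, so these denominators are already units in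
the algebra. -/
lemma isUnit_normCoord_sub {a b : Fin (m + 3)} (h : a ≠ b) :
    IsUnit (normCoord (k := k) a - normCoord b) := by
  refine IsUnit.of_mul_eq_one ⟨ratio k 1 0 a b, ratio_mem k _ _ _ _⟩
    ((normCoord_sub_mul_ratio (k := k) h 1 0).trans ?_)
  rw [normCoord_one, normCoord_zero, sub_zero]

lemma sum_dcoord {n : ℕ} : ∑ i : Fin n, dcoord k i = 0 := by
  simp only [dcoord, ← map_sum]
  rw [sum_coord, map_zero]

lemma sum_dcoord_sq {n : ℕ} : ∑ i : Fin n, dcoord k i ^ 2 = 0 := by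
  simp only [dcoord, ← map_sum, ← map_pow]
  rw [sum_coord_sq, map_zero]

/-- Translation by x₀ changes the sum by n x₀, which vanishes because n = m + 3 is zero in k. -/
lemma sum_normCoord (hm : ((m + 3 : ℕ) : k) = 0) :
    ∑ i, normCoord (k := k) (m := m) i = 0 := by
  have hm' : ((m + 3 : ℕ) : DistinctRing k (m + 3)) = 0 := by
    rw [← map_natCast (algebraMap k _), hm, map_zero]
  apply Subtype.ext
  apply (isUnit_dcoord_one_sub_zero (k := k) (m := m)).mul_left_cancel
  rw [AddSubmonoidClass.coe_finsetSum, Finset.mul_sum]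
  simp only [sub_mul_normCoord, Finset.sum_sub_distrib, sum_dcoord, Finset.sum_const,
    Finset.card_univ, Fintype.card_fin, nsmul_eq_mul, hm']
  simp

/-- Expanding (xᵢ - x₀)² gives the cross term -2x₀∑xᵢ and the term n x₀²; the first equation kills
one and n = 0 in k the other. -/
lemma sum_normCoord_sq (hm : ((m + 3 : ℕ) : k) = 0) :
    ∑ i, normCoord (k := k) (m := m) i ^ 2 = 0 := by
  have hm' : ((m + 3 : ℕ) : DistinctRing k (m + 3)) = 0 := by
    rw [← map_natCast (algebraMap k _), hm, map_zero]
  apply Subtype.ext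
  apply ((isUnit_dcoord_one_sub_zero (k := k) (m := m)).pow 2).mul_left_cancel
  rw [AddSubmonoidClass.coe_finsetSum, Finset.mul_sum]
  simp only [SubmonoidClass.coe_pow, ← mul_pow, sub_mul_normCoord]
  simp only [sub_sq, Finset.sum_sub_distrib, Finset.sum_add_distrib, sum_dcoord_sq, Finset.sum_const,
    Finset.card_univ, Fintype.card_fin, nsmul_eq_mul, hm']
  rw [← Finset.sum_mul, ← Finset.mul_sum, sum_dcoord]
  simp

open MvPolynomial in
theorem ringKrullDim_ratioAlg_succ_le (h2 : (2 : k) ≠ 0) (hm : ((m + 3 : ℕ) : k) = 0) :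
    ringKrullDim (ratioAlg k (m + 3)) + 1 ≤ m := by
  have hs := sum_normCoord hm
  have hs' := sum_normCoord_sq hm
  have h1 : (Fin.succ 0 : Fin (m + 3)) = 1 := rfl
  simp only [Fin.sum_univ_succ, normCoord_zero, h1, normCoord_one] at hs hs'
  let θ : MvPolynomial (Fin m) k →ₐ[k] ratioAlg k (m + 3) :=
    aeval fun i => normCoord i.succ.succ.succ
  have hθ : ∀ i, ∃ p, θ p = normCoord i := by
    intro i
    refine Fin.cases ⟨0, ?_⟩ (fun i => Fin.cases ⟨1, ?_⟩ (fun i => Fin.cases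
      ⟨-1 - ∑ i, X i, ?_⟩ (fun i => ⟨X i, ?_⟩) i) i) i
    · rw [map_zero, normCoord_zero]
    · rw [map_one, h1, normCoord_one]
    · simp only [θ, map_sub, map_neg, map_one, map_sum, aeval_X]
      linear_combination -hs
    · simp [θ]
  -- The relation is the sum of squares of 0, 1, y₂ = -1 - ∑Xᵢ and the Xᵢ. Its constant term is 2,
  -- so it is nonzero.
  refine ringKrullDim_succ_le_of_ker θ.toRingHom (fun b => ?_)
    (f := 1 + (1 + ∑ i, X i) ^ 2 + ∑ i, X i ^ 2) (fun h => ?_) ?_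
  · change ∃ d p, IsUnit (θ d) ∧ θ d * b = θ p
    obtain ⟨b, hb⟩ := b
    induction hb using Algebra.adjoin_induction with
    | mem x hx =>
      obtain ⟨⟨i, j, a, b⟩, rfl⟩ := hx
      by_cases hab : a = b
      · refine ⟨1, 0, by simp, Subtype.ext ?_⟩
        simp [hab, ratio_self_right]
      · obtain ⟨pi, hi⟩ := hθ i
        obtain ⟨pj, hj⟩ := hθ j
        obtain ⟨pa, ha⟩ := hθ a
        obtain ⟨pb, hb⟩ := hθ b
        refine ⟨pa - pb, pi - pj, ?_, ?_⟩
        · rw [map_sub, ha, hb]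
          exact isUnit_normCoord_sub hab
        · rw [map_sub, map_sub, ha, hb, hi, hj]
          exact normCoord_sub_mul_ratio hab i j
    | algebraMap c => exact ⟨1, C c, by simp, by simp [θ]; rfl⟩
    | add x y hx hy hx' hy' =>
      obtain ⟨d, p, hd, hp⟩ := hx'
      obtain ⟨e, q, he, hq⟩ := hy'
      refine ⟨d * e, e * p + d * q, by rw [map_mul]; exact hd.mul he, ?_⟩
      have : (⟨x + y, add_mem hx hy⟩ : ratioAlg k (m + 3)) = ⟨x, hx⟩ + ⟨y, hy⟩ := rfl
      simp only [map_add, map_mul]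
      refine (congrArg _ this).trans ?_
      linear_combination θ e * hp + θ d * hq
    | mul x y hx hy hx' hy' =>
      obtain ⟨d, p, hd, hp⟩ := hx'
      obtain ⟨e, q, he, hq⟩ := hy'
      refine ⟨d * e, p * q, by rw [map_mul]; exact hd.mul he, ?_⟩
      have : (⟨x * y, mul_mem hx hy⟩ : ratioAlg k (m + 3)) = ⟨x, hx⟩ * ⟨y, hy⟩ := rfl
      simp only [map_mul]
      refine (congrArg _ this).trans ?_
      linear_combination (θ e * ⟨y, hy⟩) * hp + θ p * hq
  · have := congrArg (aeval (0 : Fin m → k)) h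
    simp at this
    exact h2 (by linear_combination this)
  · change θ _ = 0
    simp only [θ, map_add, map_pow, map_one, map_sum, aeval_X]
    set S := ∑ i : Fin m, normCoord (k := k) i.succ.succ.succ
    linear_combination hs' - (normCoord (k := k) (m := m) (Fin.succ (Fin.succ 0)) - 1 - S) * hs

end Dimension

end

/-! ### Faithfulness of the permutation action -/

section Faithful

variable (k : Type u) [Field k] {n : ℕ}

lemma exists_algHom (h2 : (2 : k) ≠ 0) (hn : 5 ≤ n) (hn3 : (3 : k) = 0 → 6 ≤ n)
    {m j t s : Fin n} (hmt : m ≠ t) (hjt : j ≠ t) (hst : s ≠ t) :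
    ∃ e : CoordRing k n →ₐ[k] AlgebraicClosure k, e (coord k m) = 0 ∧ e (coord k j) = 0 ∧
      e (coord k t) = 1 ∧ e (coord k s) ≠ 1 := by
  obtain ⟨a, h, h', ha⟩ := exists_point (K := AlgebraicClosure k) hn (fun h3 => hn3 (by
    rw [← map_ofNat (algebraMap k (AlgebraicClosure k)) 3] at h3
    exact (map_eq_zero _).1 h3)) hmt hjt hst
  exact ⟨CoordRing.lift h2 a h h', by simpa using ha⟩

lemma coord_sub_ne_zero (h2 : (2 : k) ≠ 0) (hn : 5 ≤ n) (hn3 : (3 : k) = 0 → 6 ≤ n)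
    {i j : Fin n} (hij : i ≠ j) : coord k i - coord k j ≠ 0 := by
  obtain ⟨e, h, -, h', -⟩ := exists_algHom k h2 hn hn3 hij.symm hij.symm hij.symm
  intro h0
  have := congrArg e h0
  rw [map_sub, h, h', sub_zero, map_zero] at this
  exact one_ne_zero this

lemma discr_ne_zero (h2 : (2 : k) ≠ 0) (hn : 5 ≤ n) (hn3 : (3 : k) = 0 → 6 ≤ n) :
    discr k n ≠ 0 := by
  have := isDomain_coordRing k h2 (by omega : 4 ≤ n)
  refine Finset.prod_ne_zero_iff.2 fun i _ => Finset.prod_ne_zero_iff.2 fun j _ => ?_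
  split_ifs with h
  · exact one_ne_zero
  · exact coord_sub_ne_zero k h2 hn hn3 h

/-- The symmetric group acts faithfully on the ratios of differences of coordinates. -/
theorem exists_ratio_ne (h2 : (2 : k) ≠ 0) (hn : 5 ≤ n) (hn3 : (3 : k) = 0 → 6 ≤ n)
    {σ : Equiv.Perm (Fin n)} (hσ : σ ≠ 1) :
    ∃ i j a b, a ≠ b ∧ (coord k (σ i) - coord k (σ j)) * (coord k a - coord k b) ≠
      (coord k i - coord k j) * (coord k (σ a) - coord k (σ b)) := by
  obtain ⟨m, hm⟩ : ∃ m, σ m ≠ m := by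
    by_contra! h
    exact hσ (Equiv.ext h)
  obtain ⟨j, hj⟩ : ∃ j, j ∉ ({m, σ m} : Finset (Fin n)) := by
    by_contra! h
    have h1 := Finset.card_le_card (fun i _ => h i : Finset.univ ⊆ ({m, σ m} : Finset (Fin n)))
    have h2 := Finset.card_le_two (a := m) (b := σ m)
    rw [Finset.card_univ, Fintype.card_fin] at h1
    omega
  simp only [Finset.mem_insert, Finset.mem_singleton, not_or] at hj
  -- At this point x_m = x_j = 0 and x_{σ m} = 1. The right-hand product vanishes, while the left
  -- one is 1 - x_{σ j} ≠ 0.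
  obtain ⟨e, hem, hej, het, hes⟩ := exists_algHom k h2 hn hn3 (m := m) (j := j) (t := σ m)
    (s := σ j) hm.symm hj.2 (σ.injective.ne hj.1)
  refine ⟨m, j, σ m, j, Ne.symm hj.2, fun h => hes ?_⟩
  have := congrArg e h
  simp only [map_mul, map_sub, hem, hej, het] at this
  linear_combination -this

lemma exists_permCoord_ne (h2 : (2 : k) ≠ 0) (hn : 5 ≤ n) (hn3 : (3 : k) = 0 → 6 ≤ n)
    {σ : Equiv.Perm (Fin n)} (hσ : σ ≠ 1) : ∃ x, permCoord k n σ x ≠ x := by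
  by_contra! h
  obtain ⟨i, j, a, b, -, hne⟩ := exists_ratio_ne k h2 hn hn3 hσ
  simp only [← permCoord_coord, h] at hne
  exact hne rfl

/-- Clearing denominators in an invariant ratio gives an identity that descends to the coordinate
ring, as localization at the nonzero `discr` is injective; `exists_ratio_ne` refutes it. -/
lemma exists_ratioPerm_ne (h2 : (2 : k) ≠ 0) (hn : 5 ≤ n) (hn3 : (3 : k) = 0 → 6 ≤ n)
    {σ : Equiv.Perm (Fin n)} (hσ : σ ≠ 1) : ∃ x, ratioPerm k n σ x ≠ x := by
  have := isDomain_coordRing k h2 (by omega : 4 ≤ n)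
  obtain ⟨i, j, a, b, hab, hne⟩ := exists_ratio_ne k h2 hn hn3 hσ
  refine ⟨⟨ratio k i j a b, ratio_mem k _ _ _ _⟩, fun h => hne ?_⟩
  have h : dperm k n σ (ratio k i j a b) = ratio k i j a b := congrArg Subtype.val h
  rw [dperm_ratio] at h
  have h1 := sub_mul_ratio k hab i j
  have h2 := sub_mul_ratio k (σ.injective.ne hab) (σ i) (σ j)
  rw [h] at h2
  apply IsLocalization.injective (DistinctRing k n)
    (powers_le_nonZeroDivisors_of_noZeroDivisors (discr_ne_zero k ‹_› hn hn3))
  simp only [map_mul, map_sub]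
  change (dcoord k (σ i) - dcoord k (σ j)) * (dcoord k a - dcoord k b) =
    (dcoord k i - dcoord k j) * (dcoord k (σ a) - dcoord k (σ b))
  rw [← h1, ← h2]
  ring

end Faithful

/-! ### The compression and the bound -/

section Main

variable (k : Type u) [Field k]

/-- The locus of points of `X₁,₂` with distinct coordinates compresses to the spectrum of the
algebra of ratios of differences of coordinates. -/
theorem isCompression_ratioAlg (h2 : (2 : k) ≠ 0) {n : ℕ} (hn : 5 ≤ n)
    (hn3 : (3 : k) = 0 → 6 ≤ n) :
    IsCompression (X12 k n) (specGScheme (ratioAlg k n) (ratioPerm k n)) := by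
  have := isDomain_coordRing k h2 (by omega : 4 ≤ n)
  have hd := discr_ne_zero k h2 hn hn3
  have : IsDomain (DistinctRing k n) := IsLocalization.isDomain_localization
    (powers_le_nonZeroDivisors_of_noZeroDivisors hd)
  have := finiteType_ratioAlg k n
  refine ⟨isVariety_specGScheme _, isGenericallyFree_specGScheme _ fun σ hσ =>
    exists_ratioPerm_ne k h2 hn hn3 hσ, ⟨?_⟩⟩
  exact rationalMapOfInjective (φ := permCoord k n) hd (permCoord_discr k) (ratioPerm k n)
    (ratioAlg k n).val Subtype.val_injective fun σ x => coe_ratioPerm k σ x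

end Main

end EssDim

theorem proposition5p1 (k : Type u) [Field k] (p : ℕ) [CharP k p] (hp : 2 < p)
    (n : ℕ) (hn : 5 ≤ n) (hpn : p ∣ n) :
    (EssDim.IsVariety (EssDim.X12 k n).V ∧ EssDim.IsPrimitive (EssDim.X12 k n) ∧
        EssDim.IsGenericallyFree (EssDim.X12 k n)) ∧
      EssDim.essentialDimension (EssDim.X12 k n) ≤ ((n - 4 : ℕ) : WithBot ℕ∞) := by
  have h2 : (2 : k) ≠ 0 := by
    intro h
    have := (CharP.cast_eq_zero_iff k p 2).1 (by exact_mod_cast h)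
    exact absurd (Nat.le_of_dvd (by norm_num) this) (by omega)
  -- In characteristic 3, n is a multiple of 3 that is at least 5.
  have hn3 : (3 : k) = 0 → 6 ≤ n := by
    intro h
    have := (CharP.cast_eq_zero_iff k p 3).1 (by exact_mod_cast h)
    have hp3 : p = 3 := le_antisymm (Nat.le_of_dvd (by norm_num) this) hp
    subst hp3
    omega
  have := EssDim.isDomain_coordRing k h2 (by omega : 4 ≤ n)
  have := EssDim.isDomain_coordRing_tensorProduct k h2 (by omega : 4 ≤ n)
  refine ⟨⟨EssDim.isVariety_specGScheme (EssDim.permCoord k n),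
    EssDim.isPrimitive_specGScheme (EssDim.permCoord k n),
    EssDim.isGenericallyFree_specGScheme (EssDim.permCoord k n) fun σ hσ =>
      EssDim.exists_permCoord_ne k h2 hn hn3 hσ⟩, ?_⟩
  have hle : EssDim.essentialDimension (EssDim.X12 k n) ≤ topologicalKrullDim
      (EssDim.specGScheme (EssDim.ratioAlg k n) (EssDim.ratioPerm k n)).V.left :=
    sInf_le ⟨_, EssDim.isCompression_ratioAlg k h2 hn hn3, rfl⟩
  refine hle.trans ?_
  obtain ⟨m, rfl⟩ := Nat.exists_eq_add_of_le' (by omega : 3 ≤ n)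
  have hdim := EssDim.ringKrullDim_ratioAlg_succ_le h2 ((CharP.cast_eq_zero_iff k p _).2 hpn)
  -- Writing n = d + 4 turns the bound into dim + 1 ≤ d + 1, where 1 can be cancelled.
  obtain ⟨d, rfl⟩ := Nat.exists_eq_add_of_le' (by omega : 1 ≤ m)
  refine (PrimeSpectrum.topologicalKrullDim_eq_ringKrullDim (EssDim.ratioAlg k _)).le.trans ?_
  have hd : d + 1 + 3 - 4 = d := by omega
  rw [hd]
  push_cast at hdim
  exact ENat.WithBot.add_le_add_one_right_iff.1 hdim
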